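/- **Definitions.** Let $X$ be a finite set of Boolean variables. A *vtree* over $X$ is a rooted binary tree (every internal node has two children) whose leaves are in bijection with $X$; $\mathrm{var}(t)$ is the set of variables on the leaves below the node $t$. An *SDNNF circuit structured by* $(T,\lambda)$, with $T$ a vtree, is a Boolean circuit $D$ whose inputs are literals (or constants $0,1$) and whose other gates are binary $\lor$- and $\land$-gates, together with a map $\lambda$ from the gates of $D$ to the nodes of $T$, such that, writing $D_g$ for the subcircuit with output gate $g$: - $\mathrm{var}(D_g)\subseteq \mathrm{var}(\lambda(g))$ for every gate $g$; - $\lambda(g)=\lambda(g_1)=\lambda(g_2)$ for every gate $g=g_1\lor g_2$; - for every gate $g=g_1\land g_2$, $\lambda(g)$ has two children $t_1,t_2$, and $\lambda(g_1)$ is at or below $t_1$ and $\lambda(g_2)$ is at or below $t_2$. It is *complete* if $\mathrm{var}(D_g)=\mathrm{var}(\lambda(g))$ for every gate $g$ and $\lambda$ maps the output gate to the root of $T$. It is *deterministic* (a *d-SDNNF*) if for every gate $g=g_1\lor g_2$ the circuits $D_{g_1}$ and $D_{g_2}$ have no common satisfying assignment. Its *width* is $\max_{t}|\lambda^{-1}(t)|$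 over the nodes $t$ of $T$. An *OBDD* is a binary decision diagram (a finite directed acyclic graph with a single source, two sinks labelled $0$ and $1$, and internal nodes labelled by variables, each with one successor for each value of its variable) such that for some total order on $X$ the variables occur at most once and in increasing order along every path. Its *width* is the maximum number of nodes labelled by the same variable. **Statement.** There are Boolean functions $f_n$ over $n$ variables, $n=0,1,2,\dots$, such that 1. $f_n$ is computed by complete SDNNFs of width $O(n)$ for every vtree: there is a constant $C$ such that for every $n$ and every vtree $T$ over the $n$ variables there is a complete SDNNF circuit with vtree $T$ and of width at most $Cn$ that computes $f_n$; 2. $f_n$ is computed only by OBDDs and d-SDNNFs of width $2^{\Omega(n)}/n$: there are constants $c>0$ and $n_0$ such that for every $n\ge n_0$, every OBDD computing $f_n$ (for any variable order) and every d-SDNNF circuit computing $f_n$ (for any vtree over a subset of the $n$ variables) has width at least $2^{cn}/n$. -/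

import Mathlib

/-- Rooted binary trees with leaves labelled by variables. -/
inductive VTree (V : Type*) where
  | leaf (x : V) : VTree V
  | node (l r : VTree V) : VTree V
  deriving DecidableEq

namespace VTree

/-- The labels of the leaves, from left to right. -/
def leaves {V : Type*} : VTree V → List V
  | leaf x => [x]
  | node l r => l.leaves ++ r.leaves

/-- The nodes of a tree. A node is identified with the subtree below it: this is harmless for a
vtree, since there distinct nodes have distinct sets of variables below them. -/
def nodes {V : Type*} : VTree V → List (VTree V)
  | leaf x => [leaf x]
  | node l r => node l r :: (l.nodes ++ r.nodes)

/-- `s` is a node of the subtree below `t` (possibly `t` itself). -/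
def Below {V : Type*} (s t : VTree V) : Prop := s ∈ t.nodes

/-- `T` is a vtree over the set `X`: its leaves are in bijection with `X`. -/
def IsVTreeOver {V : Type*} (T : VTree V) (X : Set V) : Prop :=
  T.leaves.Nodup ∧ ∀ x, x ∈ T.leaves ↔ x ∈ X

end VTree

/-- Gates of a Boolean circuit in negation normal form whose gates are named by `G`.
`lit x true` is the literal `x` and `lit x false` is its negation. -/
inductive Gate (V G : Type*) where
  | lit (x : V) (sign : Bool) : Gate V G
  | const (b : Bool) : Gate V G
  | or (g₁ g₂ : G) : Gate V G
  | and (g₁ g₂ : G) : Gate V G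

/-- The gates feeding a gate. -/
def Gate.inputs {V G : Type*} : Gate V G → List G
  | lit _ _ => []
  | const _ => []
  | or g₁ g₂ => [g₁, g₂]
  | and g₁ g₂ => [g₁, g₂]

/-- Boolean circuits in negation normal form with binary gates: finite directed acyclic graphs,
whose gates are numbered along a topological order. -/
structure NNF (V : Type*) where
  size : ℕ
  gate : Fin size → Gate V (Fin size)
  acyclic : ∀ g, ∀ h ∈ (gate g).inputs, h < g
  output : Fin size

namespace NNF

/-- The value computed at gate `g` under the assignment `a`. -/
def evalAt {V : Type*} (D : NNF V) (a : V → Bool) (g : Fin D.size) : Bool :=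
  match h : D.gate g with
  | .lit x s => a x == s
  | .const b => b
  | .or g₁ g₂ => D.evalAt a g₁ || D.evalAt a g₂
  | .and g₁ g₂ => D.evalAt a g₁ && D.evalAt a g₂
termination_by g
decreasing_by
  all_goals exact D.acyclic g _ (by simp [h, Gate.inputs])

/-- The set of variables of the subcircuit with output gate `g`. -/
def varsAt {V : Type*} (D : NNF V) (g : Fin D.size) : Set V :=
  match h : D.gate g with
  | .lit x _ => {x}
  | .const _ => ∅
  | .or g₁ g₂ => D.varsAt g₁ ∪ D.varsAt g₂
  | .and g₁ g₂ => D.varsAt g₁ ∪ D.varsAt g₂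
termination_by g
decreasing_by
  all_goals exact D.acyclic g _ (by simp [h, Gate.inputs])

/-- `D` computes the Boolean function `f`. -/
def Computes {V : Type*} (D : NNF V) (f : (V → Bool) → Bool) : Prop :=
  ∀ a, D.evalAt a D.output = f a

/-- `D` is an SDNNF circuit structured by the vtree `T` and the map `lam` from gates to nodes. -/
structure StructuredBy {V : Type*} (D : NNF V) (T : VTree V) (lam : Fin D.size → VTree V) :
    Prop where
  mem_nodes : ∀ g, lam g ∈ T.nodes
  vars_subset : ∀ g, D.varsAt g ⊆ {x | x ∈ (lam g).leaves}
  or_gate : ∀ g g₁ g₂, D.gate g = .or g₁ g₂ → lam g₁ = lam g ∧ lam g₂ = lam g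
  and_gate : ∀ g g₁ g₂, D.gate g = .and g₁ g₂ → ∃ l r, lam g = .node l r ∧
    (((lam g₁).Below l ∧ (lam g₂).Below r) ∨ ((lam g₁).Below r ∧ (lam g₂).Below l))

/-- Completeness of a structured circuit: every gate depends syntactically on all the variables
below its vtree node, and the output gate sits at the root of the vtree. -/
def CompleteFor {V : Type*} (D : NNF V) (T : VTree V) (lam : Fin D.size → VTree V) : Prop :=
  (∀ g, D.varsAt g = {x | x ∈ (lam g).leaves}) ∧ lam D.output = T

/-- Determinism: the two inputs of an `∨`-gate have no common model. -/
def Deterministic {V : Type*} (D : NNF V) : Prop :=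
  ∀ g g₁ g₂, D.gate g = .or g₁ g₂ → ∀ a, ¬ (D.evalAt a g₁ = true ∧ D.evalAt a g₂ = true)

/-- The width of a circuit structured by `(T, lam)`: the largest number of gates mapped to the
same node of `T`. -/
def width {V : Type*} [DecidableEq V] (D : NNF V) (T : VTree V) (lam : Fin D.size → VTree V) : ℕ :=
  T.nodes.toFinset.sup fun t => (Finset.univ.filter fun g => lam g = t).card

end NNF

/-- Binary decision diagrams. Decision nodes are named by `Fin size`, numbered along a topological
order; `Sum.inl v` is the decision node `v` and `Sum.inr b` is the sink labelled `b`. The successor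
of `v` for the value `b` of its variable is `child v b`. The two successors may coincide. -/
structure BDD (V : Type*) where
  size : ℕ
  var : Fin size → V
  child : Fin size → Bool → Fin size ⊕ Bool
  root : Fin size ⊕ Bool
  acyclic : ∀ u b v, child u b = Sum.inl v → v < u
  single_source : ∀ v, root ≠ Sum.inl v → ∃ u b, child u b = Sum.inl v

namespace BDD

/-- The label of the sink reached from the decision node `u` under the assignment `a`. -/
def evalNode {V : Type*} (B : BDD V) (a : V → Bool) (u : Fin B.size) : Bool :=
  match h : B.child u (a (B.var u)) with
  | Sum.inl v => B.evalNode a v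
  | Sum.inr b => b
termination_by u
decreasing_by exact B.acyclic u _ v h

/-- The Boolean function represented by the diagram. -/
def eval {V : Type*} (B : BDD V) (a : V → Bool) : Bool :=
  match B.root with
  | Sum.inl v => B.evalNode a v
  | Sum.inr b => b

/-- `B` computes the Boolean function `f`. -/
def Computes {V : Type*} (B : BDD V) (f : (V → Bool) → Bool) : Prop :=
  ∀ a, B.eval a = f a

/-- `B` is an OBDD for the (strict, total) order `prec` on the variables: variables strictly
increase along every edge between decision nodes. As every decision node is reachable from the
root, this says that along every path from the root each variable occurs at most once, and that
the variables occur in an order consistent with `prec`. -/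
def OrderedBy {V : Type*} (B : BDD V) (prec : V → V → Prop) : Prop :=
  ∀ u b v, B.child u b = Sum.inl v → prec (B.var u) (B.var v)

/-- `B` is an OBDD. -/
def IsOBDD {V : Type*} (B : BDD V) : Prop :=
  ∃ prec : V → V → Prop, IsStrictTotalOrder V prec ∧ B.OrderedBy prec

/-- The width of an OBDD: the largest number of nodes labelled by the same variable. -/
def width {V : Type*} [Fintype V] [DecidableEq V] (B : BDD V) : ℕ :=
  Finset.univ.sup fun x => (Finset.univ.filter fun v => B.var v = x).card

end BDD

/-! The function is f(x) = [Hx ≠ 0] for a k × n matrix H over F₂, where k = n/6 and any n/3 columns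
of H have rank more than k - 7. Such matrices exist by a union bound
(`exists_columns_of_large_rank`).

Upper bound: Hx ≠ 0 is a disjunction of k parities. Along any vtree a parity needs only a bounded
number of gates per node, which guess how a partial sum splits between the two children. The
disjunction over the rows is not deterministic.

Lower bound: fix a set A of variables. In a d-SDNNF with a vtree node over A, or in an OBDD whose
order ends with A, the computed function is a rational combination of products e(x_A) c(x_{Aᶜ}),
with at most one product per gate or node and one more (`InSepSpan`); determinism turns each
disjunction into a sum. So the size bounds the rank of the communication matrix of f for the
partition (A, Aᶜ). If C and C' are the spans of the columns inside and outside A, then f restricted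
to inputs with column sums w, w' in C ∩ C' is [w ≠ w'], of rank at least |C ∩ C'| - 1. When A and Aᶜ
both have at least n/3 elements, dim C ∩ C' ≥ dim C + dim C' - k ≥ k - 14. Dividing the size by the
O(n) nodes of the vtree, or by the n variables, bounds the width. -/

/-! ### Separated sums and the rank bound -/

/-- `f` is a combination of the functions `E h`, with coefficients that depend only on the
variables in `B`. -/
def InSepSpan {V κ : Type*} [Fintype κ] (E : κ → (V → Bool) → ℚ) (B : Set V)
    (f : (V → Bool) → ℚ) : Prop :=
  ∃ c : κ → (V → Bool) → ℚ, (∀ h, DependsOn (c h) B) ∧ ∀ a, f a = ∑ h, E h a * c h a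

namespace InSepSpan

variable {V κ : Type*} [Fintype κ] {E : κ → (V → Bool) → ℚ} {B : Set V}

theorem add {f g : (V → Bool) → ℚ} (hf : InSepSpan E B f) (hg : InSepSpan E B g) :
    InSepSpan E B (fun a => f a + g a) := by
  obtain ⟨c, hc, hcf⟩ := hf
  obtain ⟨d, hd, hdg⟩ := hg
  refine ⟨fun h a => c h a + d h a, fun h x y hxy => ?_, fun a => ?_⟩
  · simp only [hc h hxy, hd h hxy]
  · simp only [hcf, hdg, mul_add, Finset.sum_add_distrib]

theorem mul {f g : (V → Bool) → ℚ} (hf : InSepSpan E B f) (hg : DependsOn g B) :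
    InSepSpan E B (fun a => f a * g a) := by
  obtain ⟨c, hc, hcf⟩ := hf
  refine ⟨fun h a => c h a * g a, fun h x y hxy => ?_, fun a => ?_⟩
  · simp only [hc h hxy, hg hxy]
  · simp only [hcf, Finset.sum_mul, mul_assoc]

theorem generator (h : κ) : InSepSpan E B (E h) := by
  classical
  refine ⟨fun k _ => if k = h then 1 else 0, fun k x y _ => rfl, fun a => ?_⟩
  simp

theorem of_dependsOn {f : (V → Bool) → ℚ} (h : κ) (hh : E h = fun _ => 1) (hf : DependsOn f B) :
    InSepSpan E B f := by
  have := (generator (E := E) (B := B) h).mul hf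
  simpa [hh] using this

end InSepSpan

/-- The rank bound: a function whose communication matrix contains the complement of an identity
matrix of size `card W` is not a combination of fewer than `card W - 1` products. -/
theorem InSepSpan.card_le {V κ W : Type*} [Fintype κ] [Fintype W] [DecidableEq W]
    {E : κ → (V → Bool) → ℚ} {A : Set V} [DecidablePred (· ∈ A)] {f : (V → Bool) → ℚ}
    (hf : InSepSpan E Aᶜ f) (hE : ∀ h, DependsOn (E h) A) (x y : W → V → Bool)
    (hxy : ∀ w w', f (fun v => if v ∈ A then x w v else y w' v) = if w = w' then 0 else 1) :
    Fintype.card W ≤ Fintype.card κ + 1 := by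
  obtain ⟨c, hc, hcf⟩ := hf
  -- The extra index `none` supplies the all-ones matrix J, so that P * Q = J - f is the identity.
  let P : Matrix W (Option κ) ℚ := fun w o => o.elim 1 fun h => - E h (x w)
  let Q : Matrix (Option κ) W ℚ := fun o w => o.elim 1 fun h => c h (y w)
  have hPQ : P * Q = 1 := by
    ext w w'
    have h1 := hxy w w'
    rw [hcf] at h1
    have h2 : ∀ h, E h (fun v => if v ∈ A then x w v else y w' v) = E h (x w) := fun h =>
      hE h fun v hv => by simp [hv]
    have h3 : ∀ h, c h (fun v => if v ∈ A then x w v else y w' v) = c h (y w') := fun h =>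
      hc h fun v hv => by
        have : v ∉ A := hv
        simp [this]
    simp only [h2, h3] at h1
    rw [Matrix.mul_apply, Fintype.sum_option]
    simp only [P, Q, Option.elim, neg_mul, Finset.sum_neg_distrib, h1, Matrix.one_apply]
    split_ifs <;> norm_num
  calc Fintype.card W = (1 : Matrix W W ℚ).rank := Matrix.rank_one.symm
    _ ≤ P.rank := hPQ ▸ Matrix.rank_mul_le_left P Q
    _ ≤ Fintype.card (Option κ) := Matrix.rank_le_card_width P
    _ = Fintype.card κ + 1 := Fintype.card_option

/-! ### Combinatorics of vtrees -/

namespace VTree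

variable {V : Type*}

theorem mem_nodes_self (t : VTree V) : t ∈ t.nodes := by
  cases t <;> simp [nodes]

theorem nodes_subset {s t : VTree V} (h : s ∈ t.nodes) : s.nodes ⊆ t.nodes := by
  induction t with
  | leaf x =>
    simp only [nodes, List.mem_singleton] at h
    subst h; exact List.Subset.refl _
  | node l r ihl ihr =>
    simp only [nodes, List.mem_cons, List.mem_append] at h
    rcases h with rfl | h | h
    · exact List.Subset.refl _
    · exact fun u hu => by simp [nodes, ihl h hu]
    · exact fun u hu => by simp [nodes, ihr h hu]

theorem leaves_sublist {s t : VTree V} (h : s ∈ t.nodes) : s.leaves.Sublist t.leaves := by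
  induction t with
  | leaf x =>
    simp only [nodes, List.mem_singleton] at h
    subst h; exact List.Sublist.refl _
  | node l r ihl ihr =>
    simp only [nodes, List.mem_cons, List.mem_append] at h
    rcases h with rfl | h | h
    · exact List.Sublist.refl _
    · exact (ihl h).trans (List.sublist_append_left _ _)
    · exact (ihr h).trans (List.sublist_append_right _ _)

theorem left_mem_nodes {l r t : VTree V} (h : node l r ∈ t.nodes) : l ∈ t.nodes :=
  nodes_subset h (by simp [nodes, mem_nodes_self])

theorem right_mem_nodes {l r t : VTree V} (h : node l r ∈ t.nodes) : r ∈ t.nodes :=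
  nodes_subset h (by simp [nodes, mem_nodes_self])

theorem below_or_above_or_disjoint {T s t : VTree V} (hT : T.leaves.Nodup) (hs : s ∈ T.nodes)
    (ht : t ∈ T.nodes) : s ∈ t.nodes ∨ t ∈ s.nodes ∨ s.leaves.Disjoint t.leaves := by
  induction T with
  | leaf x =>
    simp only [nodes, List.mem_singleton] at hs ht
    subst hs ht; exact Or.inl (mem_nodes_self _)
  | node l r ihl ihr =>
    have hT' := List.nodup_append'.1 hT
    rcases List.mem_cons.1 hs with rfl | hs'
    · exact Or.inr (Or.inl ht)
    rcases List.mem_cons.1 ht with rfl | ht'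
    · exact Or.inl hs
    rcases List.mem_append.1 hs' with hs' | hs' <;> rcases List.mem_append.1 ht' with ht' | ht'
    · exact ihl hT'.1 hs' ht'
    · exact Or.inr (Or.inr fun v h1 h2 =>
        hT'.2.2 ((leaves_sublist hs').subset h1) ((leaves_sublist ht').subset h2))
    · exact Or.inr (Or.inr fun v h1 h2 =>
        hT'.2.2 ((leaves_sublist ht').subset h2) ((leaves_sublist hs').subset h1))
    · exact ihr hT'.2.1 hs' ht'

theorem length_nodes_add_one (t : VTree V) : t.nodes.length + 1 = 2 * t.leaves.length := by
  induction t with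
  | leaf x => simp [nodes, leaves]
  | node l r ihl ihr =>
    simp only [nodes, leaves, List.length_cons, List.length_append]
    omega

/-- Descend from the root into a child with at least k leaves. At a node with at least 2k leaves
such a child exists, so the descent can go on until there are fewer than 2k. -/
theorem exists_balanced_node {k : ℕ} (hk : 0 < k) (t : VTree V) (ht : k ≤ t.leaves.length) :
    ∃ s ∈ t.nodes, k ≤ s.leaves.length ∧ s.leaves.length < 2 * k := by
  induction t with
  | leaf x => exact ⟨_, mem_nodes_self _, ht, by simp only [leaves, List.length_singleton]; omega⟩
  | node l r ihl ihr =>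
    by_cases h : (node l r).leaves.length < 2 * k
    · exact ⟨_, mem_nodes_self _, ht, h⟩
    simp only [leaves, List.length_append] at h
    by_cases hl : k ≤ l.leaves.length
    · obtain ⟨s, hs, h'⟩ := ihl hl
      exact ⟨s, by simp [nodes, hs], h'⟩
    · obtain ⟨s, hs, h'⟩ := ihr (by omega)
      exact ⟨s, by simp [nodes, hs], h'⟩

end VTree

/-! ### Separated sums from d-SDNNFs -/

namespace NNF

variable {V : Type*} (D : NNF V)

theorem evalAt_eq (a : V → Bool) (g : Fin D.size) : D.evalAt a g =
    match D.gate g with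
    | .lit x s => a x == s
    | .const b => b
    | .or g₁ g₂ => D.evalAt a g₁ || D.evalAt a g₂
    | .and g₁ g₂ => D.evalAt a g₁ && D.evalAt a g₂ := by
  rw [evalAt]
  split <;> rename_i h <;> rw [h]

theorem varsAt_eq (g : Fin D.size) : D.varsAt g =
    match D.gate g with
    | .lit x _ => {x}
    | .const _ => ∅
    | .or g₁ g₂ => D.varsAt g₁ ∪ D.varsAt g₂
    | .and g₁ g₂ => D.varsAt g₁ ∪ D.varsAt g₂ := by
  rw [varsAt]
  split <;> rename_i h <;> rw [h]

theorem dependsOn_evalAt (g : Fin D.size) : DependsOn (fun a => D.evalAt a g) (D.varsAt g) := by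
  induction g using WellFoundedLT.induction with
  | ind g ih =>
    intro x y hxy
    have hacyc := D.acyclic g
    rw [varsAt_eq] at hxy
    simp only [evalAt_eq D _ g]
    cases hg : D.gate g with
    | lit v s => rw [hg] at hxy; simp [hxy v rfl]
    | const b => rfl
    | or g₁ g₂ =>
      rw [hg] at hxy
      simp only [hg, Gate.inputs, List.mem_cons, List.not_mem_nil, or_false] at hacyc
      have h1 := ih g₁ (hacyc _ (Or.inl rfl)) fun i hi => hxy i (Or.inl hi)
      have h2 := ih g₂ (hacyc _ (Or.inr rfl)) fun i hi => hxy i (Or.inr hi)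
      simp only at h1 h2
      simp only [h1, h2]
    | and g₁ g₂ =>
      rw [hg] at hxy
      simp only [hg, Gate.inputs, List.mem_cons, List.not_mem_nil, or_false] at hacyc
      have h1 := ih g₁ (hacyc _ (Or.inl rfl)) fun i hi => hxy i (Or.inl hi)
      have h2 := ih g₂ (hacyc _ (Or.inr rfl)) fun i hi => hxy i (Or.inr hi)
      simp only at h1 h2
      simp only [h1, h2]

/-- The indicator function of the models of the subcircuit at `g`. -/
def indicator (g : Fin D.size) (a : V → Bool) : ℚ := bif D.evalAt a g then 1 else 0

open Classical in
/-- The indicator functions of the gates that depend only on `A`, and the constant `1`. -/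
noncomputable def localIndicator (A : Set V) : Option (Fin D.size) → (V → Bool) → ℚ
  | none => fun _ => 1
  | some g => if DependsOn (D.indicator g) A then D.indicator g else fun _ => 0

theorem dependsOn_localIndicator (A : Set V) (o : Option (Fin D.size)) :
    DependsOn (D.localIndicator A o) A := by
  cases o with
  | none => exact fun _ _ _ => rfl
  | some g =>
    simp only [localIndicator]
    split_ifs with h
    · exact h
    · exact fun _ _ _ => rfl

theorem dependsOn_indicator {g : Fin D.size} {B : Set V} (h : D.varsAt g ⊆ B) :
    DependsOn (D.indicator g) B := fun x y hxy => by
  have := D.dependsOn_evalAt g fun i hi => hxy i (h hi)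
  simp only at this
  simp only [indicator, this]

/-- Induction on gates. The generators are the gates depending only on var(t), so no new product is
ever created: ∨-gates add coefficients, and ∧-gates multiply them by a function of the outside
variables. -/
theorem StructuredBy.inSepSpan_indicator {D : NNF V} {T : VTree V} {lam : Fin D.size → VTree V}
    (hD : D.StructuredBy T lam) (hT : T.leaves.Nodup) (hdet : D.Deterministic) {t : VTree V}
    (ht : t ∈ T.nodes) (g : Fin D.size) :
    InSepSpan (D.localIndicator {x | x ∈ t.leaves}) {x | x ∈ t.leaves}ᶜ (D.indicator g) := by
  set A : Set V := {x | x ∈ t.leaves} with hA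
  induction g using WellFoundedLT.induction with
  | ind g ih =>
    by_cases hgA : DependsOn (D.indicator g) A
    · have := InSepSpan.generator (E := D.localIndicator A) (B := Aᶜ) (some g)
      simpa [localIndicator, hgA] using this
    by_cases hgB : DependsOn (D.indicator g) Aᶜ
    · exact InSepSpan.of_dependsOn none rfl hgB
    have hacyc := D.acyclic g
    cases hg : D.gate g with
    | lit v s =>
      have hv : D.varsAt g = {v} := by rw [varsAt_eq, hg]
      by_cases hvA : v ∈ A
      · exact absurd (D.dependsOn_indicator (by simpa [hv] using hvA)) hgA
      · exact absurd (D.dependsOn_indicator (by simpa [hv] using hvA)) hgB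
    | const b =>
      have hv : D.varsAt g = ∅ := by rw [varsAt_eq, hg]
      exact absurd (D.dependsOn_indicator (by simp [hv])) hgA
    | or g₁ g₂ =>
      simp only [hg, Gate.inputs, List.mem_cons, List.not_mem_nil, or_false] at hacyc
      have h := (ih g₁ (hacyc _ (Or.inl rfl))).add (ih g₂ (hacyc _ (Or.inr rfl)))
      convert h using 2 with a
      -- By determinism the indicator of the disjunction is the sum of the two indicators.
      have hd := hdet g g₁ g₂ hg a
      rw [indicator, evalAt_eq, hg]
      simp only [indicator]
      cases h1 : D.evalAt a g₁ <;> cases h2 : D.evalAt a g₂ <;> simp_all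
    | and g₁ g₂ =>
      simp only [hg, Gate.inputs, List.mem_cons, List.not_mem_nil, or_false] at hacyc
      have ih₁ := ih g₁ (hacyc _ (Or.inl rfl))
      have ih₂ := ih g₂ (hacyc _ (Or.inr rfl))
      have hmul : D.indicator g = fun a => D.indicator g₁ a * D.indicator g₂ a := by
        ext a
        rw [indicator, evalAt_eq, hg]
        simp only [indicator]
        cases D.evalAt a g₁ <;> cases D.evalAt a g₂ <;> simp
      suffices DependsOn (D.indicator g₁) Aᶜ ∨ DependsOn (D.indicator g₂) Aᶜ by
        rw [hmul]
        rcases this with h | h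
        · simpa only [mul_comm] using ih₂.mul h
        · exact ih₁.mul h
      obtain ⟨l, r, hlr, hb⟩ := hD.and_gate g g₁ g₂ hg
      have hmem := hD.mem_nodes g
      have hsub := hD.vars_subset g
      rw [hlr] at hmem hsub
      have hnodup := List.nodup_append'.1 ((VTree.leaves_sublist hmem).nodup hT)
      have key : ∀ (p q : VTree V) (g' : Fin D.size), p.leaves.Disjoint q.leaves → t ∈ p.nodes →
          (lam g').Below q → DependsOn (D.indicator g') Aᶜ := by
        intro p q g' hpq htp hq
        refine D.dependsOn_indicator fun v hv hvA => hpq ((VTree.leaves_sublist htp).subset hvA)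
          ((VTree.leaves_sublist hq).subset (hD.vars_subset g' hv))
      -- If the node of g is below t or disjoint from it, then g depends on one side only, which is
      -- already excluded. Otherwise t lies below one child of that node, and the input of g at the
      -- other child avoids var(t).
      rcases VTree.below_or_above_or_disjoint hT hmem ht with h | h | h
      · exact absurd (D.dependsOn_indicator fun v hv =>
          (VTree.leaves_sublist h).subset (hsub hv)) hgA
      · rcases List.mem_cons.1 h with h | h
        · subst h
          exact absurd (D.dependsOn_indicator hsub) hgA
        · rcases List.mem_append.1 h with h | h <;> rcases hb with hb | hb
          · exact Or.inr (key l r g₂ hnodup.2.2 h hb.2)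
          · exact Or.inl (key l r g₁ hnodup.2.2 h hb.1)
          · exact Or.inl (key r l g₁ hnodup.2.2.symm h hb.1)
          · exact Or.inr (key r l g₂ hnodup.2.2.symm h hb.2)
      · exact absurd (D.dependsOn_indicator fun v hv hvA => h (hsub hv) hvA) hgB

theorem StructuredBy.size_le [DecidableEq V] {D : NNF V} {T : VTree V}
    {lam : Fin D.size → VTree V} (hD : D.StructuredBy T lam) :
    D.size ≤ 2 * T.leaves.length * D.width T lam := by
  have h1 : D.size ≤ D.width T lam * T.nodes.toFinset.card := by
    have := Finset.card_le_mul_card_image_of_maps_to (f := lam) (s := Finset.univ)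
      (t := T.nodes.toFinset) (fun g _ => by simpa using hD.mem_nodes g) (D.width T lam)
      (fun t ht => Finset.le_sup
        (f := fun t => (Finset.univ.filter fun g => lam g = t).card) ht)
    simpa using this
  have h2 := List.toFinset_card_le T.nodes
  have h3 := T.length_nodes_add_one
  calc D.size ≤ D.width T lam * T.nodes.toFinset.card := h1
    _ ≤ D.width T lam * (2 * T.leaves.length) := Nat.mul_le_mul_left _ (by omega)
    _ = _ := Nat.mul_comm _ _

end NNF

/-! ### Separated sums from OBDDs -/

namespace BDD

variable {V : Type*} (B : BDD V)

/-- The value of the diagram below a node or sink. -/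
def evalFrom (a : V → Bool) : Fin B.size ⊕ Bool → Bool
  | .inl v => B.evalNode a v
  | .inr b => b

theorem evalNode_eq (a : V → Bool) (u : Fin B.size) :
    B.evalNode a u = B.evalFrom a (B.child u (a (B.var u))) := by
  rw [evalNode]
  split <;> rename_i h <;> rw [h] <;> rfl

theorem eval_eq (a : V → Bool) : B.eval a = B.evalFrom a B.root := by
  rw [eval]
  split <;> rename_i h <;> rw [h] <;> rfl

theorem dependsOn_evalNode {S : Set V} (hS : ∀ u b v, B.child u b = .inl v → B.var u ∈ S →
    B.var v ∈ S) (u : Fin B.size) (hu : B.var u ∈ S) : DependsOn (fun a => B.evalNode a u) S := by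
  induction u using WellFoundedLT.induction with
  | ind u ih =>
    intro x y hxy
    simp only [evalNode_eq B _ u, hxy _ hu]
    cases h : B.child u (y (B.var u)) with
    | inl v => exact ih v (B.acyclic _ _ _ h) (hS _ _ _ h hu) hxy
    | inr b => rfl

/-- The indicator function of the assignments accepted from a node or sink. -/
def indicator (s : Fin B.size ⊕ Bool) (a : V → Bool) : ℚ := bif B.evalFrom a s then 1 else 0

open Classical in
/-- The indicator functions of the nodes labelled by variables in `S`, and the constant `1`. -/
noncomputable def localIndicator (S : Set V) : Option (Fin B.size) → (V → Bool) → ℚ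
  | none => fun _ => 1
  | some u => if B.var u ∈ S then B.indicator (.inl u) else fun _ => 0

theorem dependsOn_localIndicator {S : Set V} (hS : ∀ u b v, B.child u b = .inl v → B.var u ∈ S →
    B.var v ∈ S) (o : Option (Fin B.size)) : DependsOn (B.localIndicator S o) S := by
  cases o with
  | none => exact fun _ _ _ => rfl
  | some u =>
    simp only [localIndicator]
    split_ifs with h
    · intro x y hxy
      have := B.dependsOn_evalNode hS u h hxy
      simp only at this
      simp only [indicator, evalFrom, this]
    · exact fun _ _ _ => rfl

/-- Nodes labelled in S are generators. At any other node the Shannon expansion multiplies the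
successors by literals of a variable outside S. -/
theorem inSepSpan_indicator (S : Set V) (s : Fin B.size ⊕ Bool) :
    InSepSpan (B.localIndicator S) Sᶜ (B.indicator s) := by
  have hsink : ∀ b, InSepSpan (B.localIndicator S) Sᶜ (B.indicator (.inr b)) := fun b =>
    InSepSpan.of_dependsOn none rfl fun _ _ _ => rfl
  cases s with
  | inr b => exact hsink b
  | inl u =>
    induction u using WellFoundedLT.induction with
    | ind u ih =>
      by_cases hu : B.var u ∈ S
      · have := InSepSpan.generator (E := B.localIndicator S) (B := Sᶜ) (some u)
        simpa [localIndicator, hu] using this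
      have hchild : ∀ b, InSepSpan (B.localIndicator S) Sᶜ (B.indicator (B.child u b)) := by
        intro b
        cases h : B.child u b with
        | inl v => exact ih v (B.acyclic _ _ _ h)
        | inr c => exact hsink c
      have hlit : ∀ b : Bool, DependsOn (fun a : V → Bool => if a (B.var u) = b then (1 : ℚ) else 0) Sᶜ :=
        fun b x y hxy => by simp only [hxy _ hu]
      have h := ((hchild true).mul (hlit true)).add ((hchild false).mul (hlit false))
      convert h using 2 with a
      rw [indicator, evalFrom, evalNode_eq]
      cases h : a (B.var u) <;> simp [indicator]

theorem size_le [Fintype V] [DecidableEq V] : B.size ≤ Fintype.card V * B.width := by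
  have := Finset.card_le_mul_card_image_of_maps_to (f := B.var) (s := Finset.univ)
    (t := Finset.univ) (fun g _ => Finset.mem_univ _) B.width
    (fun x hx => Finset.le_sup
      (f := fun x => (Finset.univ.filter fun v => B.var v = x).card) hx)
  simpa [mul_comm] using this

end BDD

theorem exists_initial_segment {V : Type*} [Fintype V] [DecidableEq V] (prec : V → V → Prop)
    [IsStrictTotalOrder V prec] {k : ℕ} (hk : k ≤ Fintype.card V) :
    ∃ A : Finset V, A.card = k ∧ ∀ x ∈ A, ∀ y, prec y x → y ∈ A := by
  induction k with
  | zero => exact ⟨∅, by simp⟩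
  | succ k ih =>
    obtain ⟨A, hA, hdown⟩ := ih (by omega)
    have hne : (↑Aᶜ : Set V).Nonempty := by
      rw [Finset.coe_nonempty, ← Finset.card_pos, Finset.card_compl]; omega
    have hwf : WellFounded prec := Finite.wellFounded_of_trans_of_irrefl prec
    obtain ⟨m, hm, hmin⟩ := hwf.has_min _ hne
    simp only [Finset.coe_compl, Set.mem_compl_iff, Finset.mem_coe] at hm hmin
    refine ⟨insert m A, by rw [Finset.card_insert_of_notMem hm, hA], fun x hx y hyx => ?_⟩
    rcases Finset.mem_insert.1 hx with rfl | hx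
    · by_contra hy
      exact hmin y (fun h => hy (Finset.mem_insert_of_mem h)) hyx
    · exact Finset.mem_insert_of_mem (hdown x hx y hyx)

/-! ### Matrices over F₂ without large column sets of small rank -/

-- The quotient by U has dimension at least k; φ reads off k of its coordinates. Such a φ witnesses
-- that a set of columns has small rank, and there are few enough of them for a union bound.
open Module in
theorem exists_surjective_le_ker {K V : Type*} [Field K] [AddCommGroup V] [Module K V]
    [FiniteDimensional K V] {k : ℕ} (U : Submodule K V) (h : finrank K U + k ≤ finrank K V) :
    ∃ φ : V →ₗ[K] (Fin k → K), Function.Surjective φ ∧ U ≤ LinearMap.ker φ := by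
  have hq : k ≤ finrank K (V ⧸ U) := by
    have := U.finrank_quotient_add_finrank
    omega
  let b := finBasis K (V ⧸ U)
  let π : (Fin (finrank K (V ⧸ U)) → K) →ₗ[K] (Fin k → K) := LinearMap.funLeft K K (Fin.castLE hq)
  have hπ : Function.Surjective π :=
    LinearMap.funLeft_surjective_of_injective K K _ (Fin.castLE_injective hq)
  refine ⟨π ∘ₗ b.equivFun.toLinearMap ∘ₗ U.mkQ, ?_, fun u hu => ?_⟩
  · simp only [LinearMap.coe_comp]
    exact hπ.comp (b.equivFun.surjective.comp U.mkQ_surjective)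
  · have : U.mkQ u = 0 := by simpa using hu
    rw [LinearMap.mem_ker, LinearMap.comp_apply, LinearMap.comp_apply, this, map_zero, map_zero]

open Module in
theorem card_ker_of_surjective {m k : ℕ} (φ : (Fin m → ZMod 2) →ₗ[ZMod 2] (Fin k → ZMod 2))
    (hφ : Function.Surjective φ) : Nat.card (LinearMap.ker φ) = 2 ^ (m - k) := by
  have h := φ.finrank_range_add_finrank_ker
  rw [LinearMap.range_eq_top.2 hφ, finrank_top] at h
  simp only [finrank_fin_fun] at h
  rw [Module.natCard_eq_pow_finrank (K := ZMod 2), Nat.card_zmod]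
  congr 1; omega

open Module in
/-- A union bound over all sets of `a` columns and all subspaces of codimension `k`. -/
theorem exists_columns_of_large_rank {m n k a : ℕ} (hkm : k ≤ m)
    (hlt : n + k * m < k * a) :
    ∃ h : Fin n → Fin m → ZMod 2, ∀ A : Finset (Fin n), a ≤ A.card →
      m < finrank (ZMod 2) (Submodule.span (ZMod 2) (h '' (A : Set (Fin n)))) + k := by
  classical
  by_contra! hbad
  let Φ := (Fin m → ZMod 2) →ₗ[ZMod 2] (Fin k → ZMod 2)
  have : Finite Φ := Module.finite_of_finite (ZMod 2)
  let _ : Fintype Φ := Fintype.ofFinite _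
  let F : Finset (Fin n) × Φ → Finset (Fin n → Fin m → ZMod 2) := fun p =>
    Fintype.piFinset fun v => if v ∈ p.1 then Finset.univ.filter (fun x => p.2 x = 0)
      else Finset.univ
  let I : Finset (Finset (Fin n) × Φ) :=
    Finset.univ.filter fun p => a ≤ p.1.card ∧ Function.Surjective p.2
  have hcover : (Finset.univ : Finset (Fin n → Fin m → ZMod 2)) ⊆ I.biUnion F := by
    intro h _
    obtain ⟨A, hA, hr⟩ := hbad h
    obtain ⟨φ, hφ, hker⟩ := exists_surjective_le_ker
      (Submodule.span (ZMod 2) (h '' (A : Set (Fin n)))) (k := k) (by simpa using hr)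
    refine Finset.mem_biUnion.2 ⟨(A, φ), by simp [I, hA, hφ], ?_⟩
    refine Fintype.mem_piFinset.2 fun v => ?_
    split_ifs with hv
    · have : h v ∈ LinearMap.ker φ := hker (Submodule.subset_span ⟨v, hv, rfl⟩)
      simpa using this
    · exact Finset.mem_univ _
  -- Each column in A is confined to the kernel of φ, which costs a factor 2^k per column.
  have hF : ∀ p ∈ I, (F p).card ≤ 2 ^ (m * n - k * a) := by
    rintro ⟨A, φ⟩ hp
    simp only [I, Finset.mem_filter, Finset.mem_univ, true_and] at hp
    have hker : (Finset.univ.filter (fun x => φ x = 0)).card = 2 ^ (m - k) := by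
      rw [← card_ker_of_surjective φ hp.2, Nat.card_eq_fintype_card, Fintype.card_subtype]
      simp only [LinearMap.mem_ker]
    have hAn : A.card ≤ n := by simpa using Finset.card_le_univ A
    have hcard : (F (A, φ)).card = 2 ^ ((m - k) * A.card + m * (n - A.card)) := by
      simp only [F, Fintype.card_piFinset, apply_ite Finset.card, hker, Finset.prod_ite,
        Finset.prod_const, Finset.card_univ, Fintype.card_fun, ZMod.card, Fintype.card_fin]
      have h1 : (Finset.univ.filter fun x => x ∈ A).card = A.card := by simp
      have h2 : (Finset.univ.filter fun x => x ∉ A).card = n - A.card := by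
        rw [Finset.filter_not, Finset.card_sdiff_of_subset (Finset.filter_subset _ _), h1]; simp
      rw [h1, h2, ← pow_mul, ← pow_mul, ← pow_add]
    rw [hcard]
    refine Nat.pow_le_pow_right (by norm_num) ?_
    obtain ⟨d, rfl⟩ := Nat.exists_eq_add_of_le hkm
    obtain ⟨e, he⟩ := Nat.exists_eq_add_of_le hAn
    have : k * a ≤ k * A.card := Nat.mul_le_mul_left k hp.1
    have h3 : (k + d) * n = k * A.card + (d * A.card + (k + d) * e) :=
      (congrArg _ he).trans (by ring)
    have h4 : n - A.card = e := by omega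
    rw [h4, Nat.add_sub_cancel_left]
    omega
  have hIcard : I.card ≤ 2 ^ (n + k * m) := by
    have hΦ : Fintype.card Φ = 2 ^ (k * m) := by
      rw [← Nat.card_eq_fintype_card, Module.natCard_eq_pow_finrank (K := ZMod 2), Nat.card_zmod,
        Module.finrank_linearMap, finrank_fin_fun, finrank_fin_fun, Nat.mul_comm]
    calc I.card ≤ Fintype.card (Finset (Fin n) × Φ) := Finset.card_le_univ _
      _ = 2 ^ (n + k * m) := by
        rw [Fintype.card_prod, Fintype.card_finset, Fintype.card_fin, hΦ, pow_add]
  have htotal : 2 ^ (m * n) ≤ 2 ^ (n + k * m) * 2 ^ (m * n - k * a) := by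
    calc 2 ^ (m * n) = (Finset.univ : Finset (Fin n → Fin m → ZMod 2)).card := by
          simp [pow_mul]
      _ ≤ (I.biUnion F).card := Finset.card_le_card hcover
      _ ≤ I.card * 2 ^ (m * n - k * a) := Finset.card_biUnion_le_card_mul _ _ _ hF
      _ ≤ _ := Nat.mul_le_mul_right _ hIcard
  rw [← pow_add, Nat.pow_le_pow_iff_right (by norm_num)] at htotal
  -- The exponent m * n - k * a is truncated when k * a > m * n. As k ≤ m, this would force a > n,
  -- but then no set A is large enough to be bad.
  by_cases hkan : k * a ≤ m * n
  · omega
  · by_cases han : a ≤ n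
    · exact hkan (Nat.mul_le_mul hkm han)
    · obtain ⟨A, hA, -⟩ := hbad 0
      have : A.card ≤ n := by simpa using Finset.card_le_univ A
      omega

/-! ### Complete SDNNFs for disjunctions of parities -/

/-- Rename the gates. -/
def Gate.map {V G G' : Type*} (e : G → G') : Gate V G → Gate V G'
  | .lit x s => .lit x s
  | .const b => .const b
  | .or g₁ g₂ => .or (e g₁) (e g₂)
  | .and g₁ g₂ => .and (e g₁) (e g₂)

/-- A circuit whose gates are named by any finite type and ranked along a topological order can be
turned into an `NNF`. -/
theorem NNF.exists_of_rank {V G α : Type*} [Fintype G] [LinearOrder α] (gate : G → Gate V G)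
    (rank : G → α) (hrank : ∀ g, ∀ h ∈ (gate g).inputs, rank h < rank g) (out : G) :
    ∃ (D : NNF V) (e : G ≃ Fin D.size), D.output = e out ∧
      ∀ g, D.gate (e g) = (gate g).map e := by
  let e₀ := Fintype.equivFin G
  let σ := Tuple.sort (rank ∘ e₀.symm)
  have hσ : Monotone ((rank ∘ e₀.symm) ∘ σ) := Tuple.monotone_sort _
  let e : G ≃ Fin (Fintype.card G) := e₀.trans σ.symm
  have he : ∀ g h, rank h < rank g → e h < e g := by
    intro g h hlt
    by_contra hle
    have := hσ (not_lt.1 hle)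
    simp only [e, Function.comp_apply, Equiv.trans_apply, Equiv.apply_symm_apply,
      Equiv.symm_apply_apply] at this
    exact absurd hlt (not_lt.2 this)
  refine ⟨⟨Fintype.card G, fun g => (gate (e.symm g)).map e, fun g h hh => ?_, e out⟩, e, rfl,
    fun g => by simp⟩
  have hr := hrank (e.symm g)
  have key : ∀ h', rank h' < rank (e.symm g) → e h' < g := fun h' hlt => by
    simpa using he _ _ hlt
  cases hg : gate (e.symm g) <;> rw [hg] at hr hh <;>
    simp only [Gate.map, Gate.inputs, List.mem_cons, List.not_mem_nil, or_false] at hr hh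
  · rcases hh with rfl | rfl
    · exact key _ (hr _ (Or.inl rfl))
    · exact key _ (hr _ (Or.inr rfl))
  · rcases hh with rfl | rfl
    · exact key _ (hr _ (Or.inl rfl))
    · exact key _ (hr _ (Or.inr rfl))

/-- The element of `ZMod 2` given by a bit. -/
def bitValue (c : Bool) : ZMod 2 := bif c then 1 else 0

/-- The Boolean function that accepts the vectors that are not in the kernel of the matrix `H`. -/
def notInKernel {V : Type*} [Fintype V] {k : ℕ} (H : Fin k → V → ZMod 2) (x : V → Bool) : Bool :=
  decide (∃ i, ∑ v, H i v * bitValue (x v) ≠ 0)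

namespace ParityCircuit

variable {V : Type*} {k : ℕ} (H : Fin k → V → ZMod 2)

/-- The `i`th row vanishes on the leaves of `t`. -/
def RowZero (i : Fin k) (t : VTree V) : Prop := ∀ v ∈ t.leaves, H i v = 0

instance (i : Fin k) (t : VTree V) : Decidable (RowZero H i t) := by
  unfold RowZero; infer_instance

/-- The part of the `i`th parity coming from the leaves of `t`. -/
def partialSum (i : Fin k) (t : VTree V) (a : V → Bool) : ZMod 2 :=
  (t.leaves.map fun v => H i v * bitValue (a v)).sum

/-- The names of the gates at each node of the vtree: `inl (i, b, none)` tests whether the partial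
sum of row `i` is `b`, `inl (i, b, some c)` are its two inputs, and `inr j` is the disjunction of
the tests for the first rows. -/
abbrev Label (k : ℕ) : Type := (Fin k × ZMod 2 × Option Bool) ⊕ Fin (k + 1)

/-- The `c`th way of splitting the value `b` of the partial sum of row `i` between `l` and `r`. -/
def splitValue (i : Fin k) (l r : VTree V) (b : ZMod 2) (c : Bool) : ZMod 2 × ZMod 2 :=
  -- On a zero side the test is always true, so the whole value b goes to the other side. The two
  -- choices of c then give the same split.
  if RowZero H i r then (b, 0) else if RowZero H i l then (0, b) else
    (bitValue c, b + bitValue c)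

/-- The names of the gates. -/
abbrev GateName (T : VTree V) (k : ℕ) : Type _ := {t // t ∈ T.nodes} × Label k

/-- The gates. The tests for the rows `i₀` and `row i` are joined in the disjunctions. -/
def gate (i₀ : Fin k) (row : Fin k → Fin k) (T : VTree V) :
    GateName T k → Gate V (GateName T k)
  | (⟨.leaf v, h⟩, .inl (i, b, none)) =>
    -- Completeness forces v to occur even if its coefficient is 0, and no complete gate at a leaf
    -- computes the constant 0. Hence the test becomes the tautology ¬v ∨ v for both values of b.
    if H i v = 0 then
      .or (⟨.leaf v, h⟩, .inl (i, b, some false)) (⟨.leaf v, h⟩, .inl (i, b, some true))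
    else .lit v (decide (b = 1))
  | (⟨.leaf v, _⟩, .inl (_, _, some c)) => .lit v c
  | (⟨.node l r, h⟩, .inl (i, b, none)) =>
    .or (⟨.node l r, h⟩, .inl (i, b, some false)) (⟨.node l r, h⟩, .inl (i, b, some true))
  | (⟨.node l r, h⟩, .inl (i, b, some c)) =>
    .and (⟨l, VTree.left_mem_nodes h⟩, .inl (i, (splitValue H i l r b c).1, none))
      (⟨r, VTree.right_mem_nodes h⟩, .inl (i, (splitValue H i l r b c).2, none))
  | (t, .inr j) =>
    -- The chain starts with a duplicated input, which is allowed since determinism is not required.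
    Fin.cases (.or (t, .inl (i₀, 1, none)) (t, .inl (i₀, 1, none)))
      (fun j => .or (t, .inr j.castSucc) (t, .inl (row j, 1, none))) j

/-- The rank of a label in the topological order of the gates at a node. -/
def Label.rank : Label k → ℕ
  | .inl (_, _, some _) => 0
  | .inl (_, _, none) => 1
  | .inr j => j + 2

/-- The rank of a gate in the topological order. -/
def rank {T : VTree V} (g : GateName T k) : ℕ ×ₗ ℕ := toLex (g.1.1.leaves.length, Label.rank g.2)

end ParityCircuit

theorem VTree.length_leaves_pos {V : Type*} (t : VTree V) : 0 < t.leaves.length := by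
  induction t with
  | leaf x => simp [leaves]
  | node l r ihl ihr => simp only [leaves, List.length_append]; omega

namespace ParityCircuit

variable {V : Type*} {k : ℕ} (H : Fin k → V → ZMod 2)

theorem rank_lt (i₀ : Fin k) (row : Fin k → Fin k) (T : VTree V) (g : GateName T k) :
    ∀ h ∈ (gate H i₀ row T g).inputs, rank h < rank g := by
  obtain ⟨⟨t, ht⟩, (⟨i, b, _ | c⟩ | j)⟩ := g
  · cases t with
    | leaf v =>
      rw [gate]
      split_ifs <;> simp [Gate.inputs, rank, Label.rank, Prod.Lex.toLex_lt_toLex]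
    | node l r => simp [gate, Gate.inputs, rank, Label.rank, Prod.Lex.toLex_lt_toLex]
  · cases t with
    | leaf v => simp [gate, Gate.inputs]
    | node l r =>
      have hl := l.length_leaves_pos
      have hr := r.length_leaves_pos
      simp only [gate, Gate.inputs, rank, Label.rank, Prod.Lex.toLex_lt_toLex, VTree.leaves,
        List.length_append, List.mem_cons, List.not_mem_nil, or_false, forall_eq_or_imp, forall_eq]
      omega
  · rw [gate]
    induction j using Fin.cases <;>
      simp [Gate.inputs, rank, Label.rank, Prod.Lex.toLex_lt_toLex]

theorem rowZero_node {i : Fin k} {l r : VTree V} :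
    RowZero H i (.node l r) ↔ RowZero H i l ∧ RowZero H i r := by
  simp only [RowZero, VTree.leaves, List.mem_append, or_imp, forall_and]

theorem partialSum_node (i : Fin k) (l r : VTree V) (a : V → Bool) :
    partialSum H i (.node l r) a = partialSum H i l a + partialSum H i r a := by
  simp [partialSum, VTree.leaves]

theorem partialSum_of_rowZero {i : Fin k} {t : VTree V} (h : RowZero H i t) (a : V → Bool) :
    partialSum H i t a = 0 :=
  List.sum_eq_zero (by simpa using fun v hv => Or.inl (h v hv))

/-- The inductive step of `evalAt_sum`. If neither side is zero, the two choices of c run through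
both ways of writing b as a sum in F₂. -/
theorem or_splitValue (i : Fin k) (l r : VTree V) (b : ZMod 2) (a : V → Bool) :
    (∃ c, (RowZero H i l ∨ partialSum H i l a = (splitValue H i l r b c).1) ∧
      (RowZero H i r ∨ partialSum H i r a = (splitValue H i l r b c).2)) ↔
      (RowZero H i (.node l r) ∨ partialSum H i (.node l r) a = b) := by
  rw [rowZero_node, partialSum_node]
  by_cases hr : RowZero H i r
  · simp [splitValue, hr, partialSum_of_rowZero H hr]
  by_cases hl : RowZero H i l
  · simp [splitValue, hl, hr, partialSum_of_rowZero H hl]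
  simp only [splitValue, hl, hr, false_or, if_false, false_and, Bool.exists_bool, bitValue,
    cond_true, cond_false]
  generalize partialSum H i l a = p
  generalize partialSum H i r a = q
  revert p q b
  decide

variable {T : VTree V} {i₀ : Fin k} {row : Fin k → Fin k} {D : NNF V}
  {e : GateName T k ≃ Fin D.size} (he : ∀ g, D.gate (e g) = (gate H i₀ row T g).map e)

theorem width_le [DecidableEq V] : D.width T (fun g => (e.symm g).1.1) ≤ 7 * k + 1 := by
  refine Finset.sup_le fun t _ => ?_
  calc _ ≤ (Finset.univ : Finset (Label k)).card := by
        refine Finset.card_le_card_of_injOn (fun g => (e.symm g).2) (fun _ _ => by simp) ?_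
        intro g hg g' hg' heq
        simp only [Finset.coe_filter, Finset.mem_univ, true_and, Set.mem_ofPred_eq] at hg hg'
        exact e.symm.injective (Prod.ext (Subtype.ext (hg.trans hg'.symm)) heq)
    _ ≤ 7 * k + 1 := by
        simp [ZMod.card, Fintype.card_sum]
        omega

include he

theorem varsAt_chain {t : {t // t ∈ T.nodes}}
    (h : ∀ i b, D.varsAt (e (t, .inl (i, b, none))) = {x | x ∈ t.1.leaves}) (j : Fin (k + 1)) :
    D.varsAt (e (t, .inr j)) = {x | x ∈ t.1.leaves} := by
  induction j using Fin.induction with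
  | zero => rw [NNF.varsAt_eq, he]; simp [gate, Gate.map, h]
  | succ j ih => rw [NNF.varsAt_eq, he]; simp [gate, Gate.map, h, ih]

theorem varsAt_sum (t : VTree V) (ht : t ∈ T.nodes) (i : Fin k) (b : ZMod 2) (o : Option Bool) :
    D.varsAt (e (⟨t, ht⟩, .inl (i, b, o))) = {x | x ∈ t.leaves} := by
  induction t generalizing i b o with
  | leaf v =>
    have hlit : ∀ c, D.varsAt (e (⟨.leaf v, ht⟩, .inl (i, b, some c))) =
        {x | x ∈ (VTree.leaf v).leaves} := fun c => by
      rw [NNF.varsAt_eq, he]; simp [gate, Gate.map, VTree.leaves]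
    rcases o with _ | c
    · rw [NNF.varsAt_eq, he, gate]
      split_ifs
      · simp [Gate.map, hlit]
      · simp [Gate.map, VTree.leaves]
    · exact hlit c
  | node l r ihl ihr =>
    have hsplit : ∀ c, D.varsAt (e (⟨.node l r, ht⟩, .inl (i, b, some c))) =
        {x | x ∈ (VTree.node l r).leaves} := fun c => by
      rw [NNF.varsAt_eq, he]
      simp only [gate, Gate.map, ihl, ihr]
      ext x; simp [VTree.leaves]
    rcases o with _ | c
    · rw [NNF.varsAt_eq, he]
      simp [gate, Gate.map, hsplit]
    · exact hsplit c

theorem varsAt_eq_leaves (t : VTree V) (ht : t ∈ T.nodes) (j : Label k) :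
    D.varsAt (e (⟨t, ht⟩, j)) = {x | x ∈ t.leaves} := by
  rcases j with ⟨i, b, o⟩ | j
  · exact varsAt_sum H he t ht i b o
  · exact varsAt_chain H he (fun i b => varsAt_sum H he t ht i b none) j

/-- The test is exact only where row i is nonzero; on zero parts it degenerates to true. This is
harmless when row i is nonzero on the whole vtree. -/
theorem evalAt_sum (a : V → Bool) (t : VTree V) (ht : t ∈ T.nodes) (i : Fin k) (b : ZMod 2) :
    D.evalAt a (e (⟨t, ht⟩, .inl (i, b, none))) = true ↔
      RowZero H i t ∨ partialSum H i t a = b := by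
  induction t generalizing i b with
  | leaf v =>
    have hlit : ∀ i b c, D.evalAt a (e (⟨.leaf v, ht⟩, .inl (i, b, some c))) = (a v == c) :=
      fun i b c => by rw [NNF.evalAt_eq, he]; simp [gate, Gate.map]
    rw [NNF.evalAt_eq, he, gate]
    split_ifs with hv
    · simp [Gate.map, hlit, RowZero, VTree.leaves, hv]
    · have hv1 : H i v = 1 := by
        revert hv; generalize H i v = p; revert p; decide
      simp only [Gate.map, RowZero, partialSum, VTree.leaves, List.mem_singleton, forall_eq,
        List.map_cons, List.map_nil, List.sum_cons, List.sum_nil, hv1, one_mul, add_zero,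
        bitValue]
      generalize a v = c
      revert b c
      decide
  | node l r ihl ihr =>
    have hsplit : ∀ c, D.evalAt a (e (⟨.node l r, ht⟩, .inl (i, b, some c))) = true ↔
        (RowZero H i l ∨ partialSum H i l a = (splitValue H i l r b c).1) ∧
          (RowZero H i r ∨ partialSum H i r a = (splitValue H i l r b c).2) := fun c => by
      rw [NNF.evalAt_eq, he]
      simp only [gate, Gate.map, Bool.and_eq_true, ihl, ihr]
    rw [NNF.evalAt_eq, he, ← or_splitValue]
    simp only [gate, Gate.map, Bool.or_eq_true, hsplit, Bool.exists_bool]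

theorem evalAt_chain (a : V → Bool) (t : {t // t ∈ T.nodes}) (j : Fin (k + 1)) :
    D.evalAt a (e (t, .inr j)) = true ↔
      D.evalAt a (e (t, .inl (i₀, 1, none))) = true ∨
        ∃ i : Fin k, i.1 < j.1 ∧ D.evalAt a (e (t, .inl (row i, 1, none))) = true := by
  induction j using Fin.induction with
  | zero => rw [NNF.evalAt_eq, he]; simp [gate, Gate.map]
  | succ j ih =>
    rw [NNF.evalAt_eq, he]
    simp only [gate, Gate.map, Fin.cases_succ, Bool.or_eq_true, ih, or_assoc, Fin.val_succ,
      Fin.val_castSucc]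
    refine or_congr_right ⟨?_, ?_⟩
    · rintro (⟨i, hi, h⟩ | h)
      · exact ⟨i, by omega, h⟩
      · exact ⟨j, by omega, h⟩
    · rintro ⟨i, hi, h⟩
      by_cases hij : i = j
      · exact Or.inr (hij ▸ h)
      · exact Or.inl ⟨i, by have := Fin.val_ne_of_ne hij; omega, h⟩

theorem structuredBy : D.StructuredBy T fun g => (e.symm g).1.1 where
  mem_nodes g := (e.symm g).1.2
  vars_subset g := by
    obtain ⟨⟨⟨t, ht⟩, j⟩, rfl⟩ := e.surjective g
    rw [varsAt_eq_leaves H he]; simp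
  or_gate g g₁ g₂ hg := by
    obtain ⟨⟨⟨t, ht⟩, j⟩, rfl⟩ := e.surjective g
    rw [he] at hg
    rcases j with ⟨i, b, _ | c⟩ | j
    · cases t with
      | leaf v =>
        rw [gate] at hg
        split_ifs at hg
        · simp only [Gate.map, Gate.or.injEq] at hg
          simp [← hg.1, ← hg.2]
        · simp [Gate.map] at hg
      | node l r =>
        simp only [gate, Gate.map, Gate.or.injEq] at hg
        simp [← hg.1, ← hg.2]
    · cases t <;> simp [gate, Gate.map] at hg
    · induction j using Fin.cases <;> simp only [gate, Fin.cases_zero, Fin.cases_succ, Gate.map,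
        Gate.or.injEq] at hg <;> simp [← hg.1, ← hg.2]
  and_gate g g₁ g₂ hg := by
    obtain ⟨⟨⟨t, ht⟩, j⟩, rfl⟩ := e.surjective g
    rw [he] at hg
    rcases j with ⟨i, b, _ | c⟩ | j
    · cases t with
      | leaf v =>
        rw [gate] at hg
        split_ifs at hg <;> simp [Gate.map] at hg
      | node l r => simp [gate, Gate.map] at hg
    · cases t with
      | leaf v => simp [gate, Gate.map] at hg
      | node l r =>
        simp only [gate, Gate.map, Gate.and.injEq] at hg
        refine ⟨l, r, by simp, Or.inl ⟨?_, ?_⟩⟩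
        · simp [← hg.1, VTree.Below, VTree.mem_nodes_self]
        · simp [← hg.2, VTree.Below, VTree.mem_nodes_self]
    · induction j using Fin.cases <;> simp [gate, Gate.map] at hg

end ParityCircuit

theorem exists_complete_sdnnf_notInKernel {n k : ℕ} (H : Fin k → Fin n → ZMod 2) (hH : H ≠ 0)
    (T : VTree (Fin n)) (hT : T.IsVTreeOver Set.univ) :
    ∃ (D : NNF (Fin n)) (lam : Fin D.size → VTree (Fin n)), D.StructuredBy T lam ∧
      D.CompleteFor T lam ∧ D.Computes (notInKernel H) ∧ D.width T lam ≤ 7 * k + 1 := by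
  classical
  have hmem : ∀ v, v ∈ T.leaves := fun v => (hT.2 v).2 trivial
  obtain ⟨i₀, hi₀⟩ : ∃ i₀, ¬ ParityCircuit.RowZero H i₀ T := by
    by_contra! h
    exact hH (funext fun i => funext fun v => h i v (hmem v))
  -- The test for a zero row would accept everything, so zero rows are replaced by the nonzero row
  -- i₀, which exists because H ≠ 0.
  let row : Fin k → Fin k := fun i => if ParityCircuit.RowZero H i T then i₀ else i
  let out : ParityCircuit.GateName T k := (⟨T, T.mem_nodes_self⟩, .inr (Fin.last k))
  let _ : Fintype {t // t ∈ T.nodes} := Fintype.ofFinite _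
  obtain ⟨D, e, hout, he⟩ := NNF.exists_of_rank (ParityCircuit.gate H i₀ row T)
    ParityCircuit.rank (ParityCircuit.rank_lt H i₀ row T) out
  refine ⟨D, fun g => (e.symm g).1.1, ParityCircuit.structuredBy H he, ⟨fun g => ?_, ?_⟩,
    fun a => ?_, ParityCircuit.width_le⟩
  · obtain ⟨⟨⟨t, ht⟩, j⟩, rfl⟩ := e.surjective g
    rw [ParityCircuit.varsAt_eq_leaves H he]; simp
  · simp [hout, out]
  have hsum : ∀ i, ParityCircuit.partialSum H i T a = ∑ v, H i v * bitValue (a v) := fun i => by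
    rw [ParityCircuit.partialSum, ← List.sum_toFinset _ hT.1]
    congr 1
    ext v; simp [hmem]
  have hrow : ∀ i, ¬ ParityCircuit.RowZero H (row i) T := fun i => by
    simp only [row]; split_ifs with h
    · exact hi₀
    · exact h
  have hone : ∀ p : ZMod 2, p ≠ 0 ↔ p = 1 := by decide
  rw [Bool.eq_iff_iff, hout, ParityCircuit.evalAt_chain H he]
  simp only [ParityCircuit.evalAt_sum H he, hi₀, hrow, false_or, notInKernel, decide_eq_true_eq,
    hone, ← hsum, Fin.val_last, Fin.is_lt, true_and]
  constructor
  · rintro (h | ⟨i, h⟩)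
    · exact ⟨_, h⟩
    · exact ⟨_, h⟩
  · rintro ⟨i, h⟩
    refine Or.inr ⟨i, ?_⟩
    have : ¬ ParityCircuit.RowZero H i T := fun hz => by
      rw [ParityCircuit.partialSum_of_rowZero H hz] at h
      exact absurd h (by decide)
    simpa only [row, this, if_false] using h

/-! ### Communication rank of the kernel test -/

/-- The span of the columns of `H` with index in `A`. -/
def columnSpan {V : Type*} {k : ℕ} (H : Fin k → V → ZMod 2) (A : Set V) :
    Submodule (ZMod 2) (Fin k → ZMod 2) :=
  Submodule.span (ZMod 2) ((fun v i => H i v) '' A)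

theorem exists_sum_of_mem_columnSpan {V : Type*} {k : ℕ}
    {H : Fin k → V → ZMod 2} {A : Finset V} {w : Fin k → ZMod 2} (hw : w ∈ columnSpan H A) :
    ∃ x : V → Bool, ∀ i, ∑ v ∈ A, H i v * bitValue (x v) = w i := by
  obtain ⟨c, rfl⟩ := (Submodule.mem_span_image_finset_iff_exists_fun' (ZMod 2)).1 hw
  have hbit : ∀ p : ZMod 2, bitValue (decide (p = 1)) = p := by decide
  refine ⟨fun v => decide (c v = 1), fun i => ?_⟩
  simp [hbit, mul_comm]

open Module in
/-- The communication matrix of `notInKernel H` has large rank if the columns in `A` and those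
outside `A` both span large spaces. -/
theorem two_pow_le_of_inSepSpan {V κ : Type*} [Fintype V] [DecidableEq V] [Fintype κ] {k : ℕ}
    {H : Fin k → V → ZMod 2} {A : Finset V} {E : κ → (V → Bool) → ℚ}
    (hf : InSepSpan E (A : Set V)ᶜ (fun a => bif notInKernel H a then 1 else 0))
    (hE : ∀ h, DependsOn (E h) (A : Set V)) :
    2 ^ (finrank (ZMod 2) (columnSpan H A) + finrank (ZMod 2) (columnSpan H ↑Aᶜ) - k) ≤
      Fintype.card κ + 1 := by
  classical
  -- A vector w in both spans is a column sum over A and also one over Aᶜ. Mixing the assignments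
  -- for w and w' gives Hx = w + w', which vanishes exactly when w = w'.
  let W := ↥(columnSpan H A ⊓ columnSpan H ↑Aᶜ)
  have hx : ∀ w : W, ∃ x : V → Bool, ∀ i, ∑ v ∈ A, H i v * bitValue (x v) = w.1 i := fun w =>
    exists_sum_of_mem_columnSpan w.2.1
  have hy : ∀ w : W, ∃ x : V → Bool, ∀ i, ∑ v ∈ Aᶜ, H i v * bitValue (x v) = w.1 i := fun w =>
    exists_sum_of_mem_columnSpan w.2.2
  choose x hx using hx
  choose y hy using hy
  let _ : Fintype W := Fintype.ofFinite W
  have hcard := InSepSpan.card_le (A := (A : Set V)) hf hE x y fun w w' => by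
    have hsum : ∀ i, ∑ v, H i v * bitValue (if v ∈ (A : Set V) then x w v else y w' v) =
        w.1 i + w'.1 i := fun i => by
      rw [← Finset.sum_add_sum_compl A, ← hx, ← hy]
      congr 1
      · exact Finset.sum_congr rfl fun v hv => by simp [hv]
      · exact Finset.sum_congr rfl fun v hv => by simp [Finset.mem_compl.1 hv]
    have hadd : ∀ p q : ZMod 2, p + q ≠ 0 ↔ p ≠ q := by decide
    have hiff : (∃ i, w.1 i ≠ w'.1 i) ↔ w ≠ w' := by
      rw [← Function.ne_iff, Ne, Ne, Subtype.ext_iff]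
    simp only [notInKernel, hsum, hadd, hiff]
    by_cases h : w = w' <;> simp [h]
  refine le_trans ?_ hcard
  rw [← Nat.card_eq_fintype_card, Module.natCard_eq_pow_finrank (K := ZMod 2), Nat.card_zmod]
  refine Nat.pow_le_pow_right (by norm_num) ?_
  have h1 := Submodule.finrank_sup_add_finrank_inf_eq (columnSpan H A) (columnSpan H ↑Aᶜ)
  have h2 := Submodule.finrank_le (columnSpan H A ⊔ columnSpan H ↑Aᶜ)
  rw [finrank_fin_fun] at h2
  simp only [W]
  omega

/-! ### Width lower bounds from large column rank -/

open Module in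
/-- Any `a` columns of `H` have rank more than `k - d`. -/
def HasLargeRank {n k : ℕ} (H : Fin k → Fin n → ZMod 2) (a d : ℕ) : Prop :=
  ∀ A : Finset (Fin n), a ≤ A.card → k < finrank (ZMod 2) (columnSpan H (A : Set (Fin n))) + d

theorem HasLargeRank.two_pow_le {n k a d : ℕ} {H : Fin k → Fin n → ZMod 2}
    (hH : HasLargeRank H a d) {κ : Type*} [Fintype κ] {A : Finset (Fin n)} (hA : a ≤ A.card)
    (hA' : A.card + a ≤ n) {E : κ → (Fin n → Bool) → ℚ}
    (hf : InSepSpan E (A : Set (Fin n))ᶜ (fun a => bif notInKernel H a then 1 else 0))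
    (hE : ∀ h, DependsOn (E h) (A : Set (Fin n))) : 2 ^ (k - 2 * d) ≤ Fintype.card κ + 1 := by
  refine le_trans (Nat.pow_le_pow_right (by norm_num) ?_) (two_pow_le_of_inSepSpan hf hE)
  have h1 := hH A hA
  have h2 := hH Aᶜ (by rw [Finset.card_compl, Fintype.card_fin]; omega)
  omega

theorem HasLargeRank.two_pow_le_width_bdd {n k a d : ℕ} {H : Fin k → Fin n → ZMod 2}
    (hH : HasLargeRank H a d) (ha : 2 * a ≤ n) {B : BDD (Fin n)} (hB : B.IsOBDD)
    (hBf : B.Computes (notInKernel H)) : 2 ^ (k - 2 * d) ≤ n * B.width + 2 := by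
  obtain ⟨prec, _, hord⟩ := hB
  -- The set used for the partition is the complement of I: the last a variables, a set closed under
  -- passing to successors.
  obtain ⟨I, hI, hdown⟩ := exists_initial_segment prec (k := n - a) (by simp)
  have hS : ∀ u b v, B.child u b = .inl v → B.var u ∈ (↑Iᶜ : Set (Fin n)) →
      B.var v ∈ (↑Iᶜ : Set (Fin n)) := fun u b v h hu => by
    simp only [Finset.coe_compl, Set.mem_compl_iff, Finset.mem_coe] at hu ⊢
    exact fun hv => hu (hdown _ hv _ (hord u b v h))
  have hIc : Iᶜ.card = a := by rw [Finset.card_compl, Fintype.card_fin, hI]; omega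
  have hspan := B.inSepSpan_indicator (↑Iᶜ : Set (Fin n)) B.root
  have hind : B.indicator B.root = fun a => bif notInKernel H a then 1 else 0 := by
    ext a
    rw [BDD.indicator, ← BDD.eval_eq, hBf a]
  rw [hind] at hspan
  have h := hH.two_pow_le hIc.ge (by omega) hspan (B.dependsOn_localIndicator hS)
  have hs := B.size_le
  simp only [Fintype.card_option, Fintype.card_fin] at h hs
  omega

theorem exists_notInKernel_ne {n k : ℕ} {H : Fin k → Fin n → ZMod 2} {v : Fin n}
    (hv : ∃ i, H i v ≠ 0) : notInKernel H (fun _ => false) ≠ notInKernel H (fun u => u == v) := by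
  have h0 : notInKernel H (fun _ => false) = false := by simp [notInKernel, bitValue]
  have h1 : notInKernel H (fun u => u == v) = true := by
    obtain ⟨i, hi⟩ := hv
    refine decide_eq_true ⟨i, ?_⟩
    rw [Finset.sum_eq_single v]
    · simpa [bitValue] using hi
    · intro u _ hu; simp [bitValue, beq_eq_false_iff_ne.2 hu]
    · simp
  rw [h0, h1]; exact Bool.false_ne_true

theorem HasLargeRank.two_pow_le_width_nnf {n k a d : ℕ} {H : Fin k → Fin n → ZMod 2}
    (hH : HasLargeRank H a d) (ha0 : 0 < a) (ha : 3 * a ≤ n) (hdk : d ≤ k) {D : NNF (Fin n)}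
    {X : Set (Fin n)} {T : VTree (Fin n)} {lam : Fin D.size → VTree (Fin n)}
    (hT : T.IsVTreeOver X) (hD : D.StructuredBy T lam) (hdet : D.Deterministic)
    (hDf : D.Computes (notInKernel H)) : 2 ^ (k - 2 * d) ≤ 2 * n * D.width T lam + 2 := by
  have hlen : T.leaves.toFinset.card = T.leaves.length := List.toFinset_card_of_nodup hT.1
  have hlen' : T.leaves.length ≤ n := by
    rw [← hlen]; simpa using Finset.card_le_univ T.leaves.toFinset
  -- The vtree may omit variables, but flipping an omitted one cannot change the function, so its
  -- column is zero.
  have hzero : ∀ v ∉ T.leaves, ∀ i, H i v = 0 := by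
    intro v hv
    by_contra! h
    refine exists_notInKernel_ne h ?_
    rw [← hDf, ← hDf]
    refine D.dependsOn_evalAt D.output fun u hu => ?_
    have : u ≠ v := fun huv => hv (huv ▸
      (VTree.leaves_sublist (hD.mem_nodes _)).subset (hD.vars_subset _ hu))
    simp [this]
  -- Otherwise more than n - a ≥ a columns vanish, and a set of rank 0 contradicts d ≤ k.
  have hlarge : a ≤ T.leaves.length := by
    by_contra! hlt
    have h1 := hH T.leaves.toFinsetᶜ (by
      rw [Finset.card_compl, Fintype.card_fin, hlen]; omega)
    have h2 : columnSpan H (↑T.leaves.toFinsetᶜ : Set (Fin n)) = ⊥ := by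
      rw [columnSpan, Submodule.span_eq_bot]
      rintro _ ⟨v, hv, rfl⟩
      exact funext fun i => hzero v (by simpa using hv) i
    rw [h2, finrank_bot] at h1
    omega
  -- With a ≤ |var(t)| < 2a and 3a ≤ n, both sides of the partition have at least a variables.
  obtain ⟨t, ht, hta, hta'⟩ := T.exists_balanced_node ha0 hlarge
  have htlen : t.leaves.toFinset.card = t.leaves.length :=
    List.toFinset_card_of_nodup ((VTree.leaves_sublist ht).nodup hT.1)
  have hspan := hD.inSepSpan_indicator hT.1 hdet ht D.output
  have hind : D.indicator D.output = fun a => bif notInKernel H a then 1 else 0 := by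
    ext a
    rw [NNF.indicator, hDf a]
  have hcoe : {x | x ∈ t.leaves} = (↑t.leaves.toFinset : Set (Fin n)) := by ext; simp
  rw [hind, hcoe] at hspan
  have h := hH.two_pow_le (by omega) (by omega) hspan (D.dependsOn_localIndicator _)
  have hs := hD.size_le
  have hs' : 2 * T.leaves.length * D.width T lam ≤ 2 * n * D.width T lam :=
    Nat.mul_le_mul_right _ (by omega)
  simp only [Fintype.card_option, Fintype.card_fin] at h
  omega

theorem HasLargeRank.ne_zero {n k a d : ℕ} {H : Fin k → Fin n → ZMod 2}
    (hH : HasLargeRank H a d) (ha : a ≤ n) (hdk : d ≤ k) : H ≠ 0 := by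
  rintro rfl
  have h1 := hH Finset.univ (by simpa using ha)
  have h2 : columnSpan (0 : Fin k → Fin n → ZMod 2) (↑(Finset.univ : Finset (Fin n))) = ⊥ := by
    rw [columnSpan, Submodule.span_eq_bot]
    rintro _ ⟨v, -, rfl⟩
    rfl
  rw [h2, finrank_bot] at h1
  omega

/-! ### Choice of parameters -/

theorem exists_hasLargeRank {n : ℕ} (hn : 100 ≤ n) :
    ∃ H : Fin (n / 6) → Fin n → ZMod 2, HasLargeRank H (n / 3) 7 := by
  -- Up to rounding, n + k · n/6 < k · n/3 means k > 6, hence the codimension 7.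
  obtain ⟨h, hh⟩ := exists_columns_of_large_rank (m := n / 6) (n := n) (k := 7) (a := n / 3)
    (by omega) (by omega)
  exact ⟨fun i v => h v i, hh⟩

theorem two_rpow_div_le {n w : ℕ} (hn : 240 ≤ n)
    (h : 2 ^ (n / 6 - 2 * 7) ≤ 2 * n * w + 2) : (2 : ℝ) ^ ((1 / 12 : ℝ) * n) / n ≤ w := by
  -- Giving up a factor 4 absorbs both the factor 2 and the additive 2.
  have hpow : 2 ^ (n / 6 - 16) ≤ n * w := by
    have h1 : 2 ^ (n / 6 - 2 * 7) = 4 * 2 ^ (n / 6 - 16) := by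
      rw [show n / 6 - 2 * 7 = n / 6 - 16 + 2 by omega, pow_add]; ring
    have h2 : 1 ≤ 2 ^ (n / 6 - 16) := Nat.one_le_two_pow
    rw [h1, mul_assoc] at h
    omega
  have hexp : (1 / 12 : ℝ) * n ≤ ((n / 6 - 16 : ℕ) : ℝ) := by
    have : n ≤ 12 * (n / 6 - 16) := by omega
    have : (n : ℝ) ≤ 12 * ((n / 6 - 16 : ℕ) : ℝ) := by exact_mod_cast this
    linarith
  have hn0 : (0 : ℝ) < n := by exact_mod_cast (by omega : 0 < n)
  rw [div_le_iff₀ hn0]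
  calc (2 : ℝ) ^ ((1 / 12 : ℝ) * n) ≤ (2 : ℝ) ^ ((n / 6 - 16 : ℕ) : ℝ) :=
        Real.rpow_le_rpow_of_exponent_le (by norm_num) hexp
    _ = ((2 ^ (n / 6 - 16) : ℕ) : ℝ) := by rw [Real.rpow_natCast]; norm_cast
    _ ≤ ((n * w : ℕ) : ℝ) := by exact_mod_cast hpow
    _ = w * n := by push_cast; ring

theorem exists_matrix (n : ℕ) : ∃ (k : ℕ) (H : Fin k → Fin n → ZMod 2), k ≤ n ∧
    (0 < n → H ≠ 0) ∧ (240 ≤ n → k = n / 6 ∧ HasLargeRank H (n / 3) 7) := by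
  by_cases hn : 240 ≤ n
  · obtain ⟨H, hH⟩ := exists_hasLargeRank (n := n) (by omega)
    exact ⟨n / 6, H, by omega, fun _ => hH.ne_zero (by omega) (by omega), fun _ => ⟨rfl, hH⟩⟩
  -- For small n only the upper bound matters, and any nonzero matrix with at most n rows will do.
  · refine ⟨n, fun _ _ => 1, le_rfl, fun h0 h => ?_, fun h => absurd h hn⟩
    exact one_ne_zero (congrFun (congrFun h ⟨0, h0⟩) ⟨0, h0⟩)

theorem mainTheorem9 :
    ∃ f : (n : ℕ) → (Fin n → Bool) → Bool,
      (∃ C : ℕ, ∀ (n : ℕ) (T : VTree (Fin n)), T.IsVTreeOver Set.univ →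
        ∃ (D : NNF (Fin n)) (lam : Fin D.size → VTree (Fin n)),
          D.StructuredBy T lam ∧ D.CompleteFor T lam ∧ D.Computes (f n) ∧
            D.width T lam ≤ C * n) ∧
      (∃ c : ℝ, 0 < c ∧ ∃ n₀ : ℕ, ∀ n ≥ n₀,
        (∀ B : BDD (Fin n), B.IsOBDD → B.Computes (f n) →
          (2 : ℝ) ^ (c * n) / n ≤ (B.width : ℝ)) ∧
        (∀ (D : NNF (Fin n)) (X : Set (Fin n)) (T : VTree (Fin n))
            (lam : Fin D.size → VTree (Fin n)),
          T.IsVTreeOver X → D.StructuredBy T lam → D.Deterministic → D.Computes (f n) →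
            (2 : ℝ) ^ (c * n) / n ≤ (D.width T lam : ℝ))) := by
  choose k H hk hne hlarge using exists_matrix
  refine ⟨fun n => notInKernel (H n), ⟨8, fun n T hT => ?_⟩, 1 / 12, by norm_num, 240,
    fun n hn => ⟨fun B hB hBf => ?_, fun D X T lam hT hD hdet hDf => ?_⟩⟩
  -- There is no vtree over the empty set. For n > 0 and k ≤ n, 7k + 1 ≤ 8n.
  · have hn : 0 < n := by
      have h1 : T.leaves.toFinset.card ≤ n := by simpa using Finset.card_le_univ T.leaves.toFinset
      rw [List.toFinset_card_of_nodup hT.1] at h1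
      exact T.length_leaves_pos.trans_le h1
    obtain ⟨D, lam, h1, h2, h3, h4⟩ := exists_complete_sdnnf_notInKernel (H n) (hne n hn) T hT
    have := hk n
    exact ⟨D, lam, h1, h2, h3, by omega⟩
  · obtain ⟨hkn, hrank⟩ := hlarge n hn
    have h := hrank.two_pow_le_width_bdd (by omega) hB hBf
    rw [hkn] at h
    refine two_rpow_div_le hn (h.trans ?_)
    rw [mul_assoc]
    omega
  · obtain ⟨hkn, hrank⟩ := hlarge n hn
    have h := hrank.two_pow_le_width_nnf (by omega) (by omega) (by omega) hT hD hdet hDf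
    rw [hkn] at h
    exact two_rpow_div_le hn h
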